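/- Let $\Gamma \subset \mathbb{R}^2$ be a smooth convex body, i.e. a compact convex set with nonempty interior such that through each boundary point of $\Gamma$ there is a unique tangent (supporting) line. For a set $S \subseteq \mathbb{R}^2$, call a pair $(a,b)$ of distinct points of $S$ a candidate pair if, for some translate $\Gamma_p = p + \Gamma$ with $p \in \mathbb{R}^2$, it is a closest pair in $S \cap \Gamma_p$, i.e. $a, b \in S \cap \Gamma_p$ and $\mathrm{dist}(a,b) \le \mathrm{dist}(x,y)$ for all distinct $x,y \in S \cap \Gamma_p$ (Euclidean distance). Then there exists a constant $\tau > 0$, depending on $\Gamma$ only, such that for every set $S \subseteq \mathbb{R}^2$ the following holds. 1. If $(a,b)$ and $(c,d)$ are two candidate pairs in $S$ with $\mathrm{dist}(a,b) \le \tau$ and $\mathrm{dist}(c,d) \le \tau$, then the segments $[a,b]$ and $[c,d]$ do not cross. Here two segments are said to cross if they are different and have a common point that is not a common endpoint. 2. If $S$ is finite, then the graph with vertex set $S$ whose edges are the candidate pairs of length at most $\tau$ is planar; indeed, drawing each edge as the segment joining its two points is a drawing in the plane without crossings. -/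

import Mathlib

/-- The plane `ℝ²` with the Euclidean metric. -/
abbrev Plane : Type := EuclideanSpace ℝ (Fin 2)

/-- `L` is a tangent (supporting) line of `C` through `x`: a line through `x` such that `C` lies in
one of its two closed sides. -/
def IsTangentLine (C : Set Plane) (x : Plane) (L : Set Plane) : Prop :=
  ∃ v : Plane, v ≠ 0 ∧ L = {y | inner ℝ v y = inner ℝ v x} ∧ ∀ y ∈ C, inner ℝ v y ≤ inner ℝ v x

/-- A smooth convex body: a compact convex set with nonempty interior, such that through each
boundary point there is a unique tangent line. -/
structure IsSmoothConvexBody (C : Set Plane) : Prop where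
  isCompact : IsCompact C
  convex : Convex ℝ C
  interior_nonempty : (interior C).Nonempty
  smooth : ∀ x ∈ frontier C, ∃! L : Set Plane, IsTangentLine C x L

/-- The collection of all translates `p + Γ` of `Γ`. -/
def translates (Γ : Set Plane) : Set (Set Plane) :=
  {X | ∃ p : Plane, X = (fun x => p + x) '' Γ}

/-- `(a, b)` is a closest pair of the point set `T`: two different points of `T` whose distance is
minimal among all pairs of different points of `T`. -/
def IsClosestPair (T : Set Plane) (a b : Plane) : Prop :=
  a ∈ T ∧ b ∈ T ∧ a ≠ b ∧ ∀ x ∈ T, ∀ y ∈ T, x ≠ y → dist a b ≤ dist x y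

/-- The candidate pairs in `S` with respect to a collection `𝒳` of ranges. -/
def candidatePairs (S : Set Plane) (𝒳 : Set (Set Plane)) : Set (Plane × Plane) :=
  {φ | ∃ X ∈ 𝒳, IsClosestPair (S ∩ X) φ.1 φ.2}

/-- The segments `[a, b]` and `[c, d]` cross: they are different segments and have a common point
that is not a common endpoint. Proper crossings, touchings of an endpoint of one segment with the
relative interior of the other one, and overlaps are all included. -/
def SegmentsCross (a b c d : Plane) : Prop :=
  s(a, b) ≠ s(c, d) ∧
    ∃ x ∈ segment ℝ a b ∩ segment ℝ c d, ¬ (x ∈ ({a, b} : Set Plane) ∧ x ∈ ({c, d} : Set Plane))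

theorem IsClosestPair.symm {T : Set Plane} {a b : Plane} (h : IsClosestPair T a b) :
    IsClosestPair T b a :=
  ⟨h.2.1, h.1, h.2.2.1.symm, fun x hx y hy hxy => dist_comm a b ▸ h.2.2.2 x hx y hy hxy⟩

/-- The graph with vertex set `S` whose edges are the candidate pairs of length at most `τ`. -/
def shortCandidateGraph (S : Set Plane) (𝒳 : Set (Set Plane)) (τ : ℝ) : SimpleGraph S where
  Adj u v := ((u : Plane), (v : Plane)) ∈ candidatePairs S 𝒳 ∧ dist (u : Plane) (v : Plane) ≤ τ
  symm := ⟨fun u v h => ⟨let ⟨X, hX, hc⟩ := h.1; ⟨X, hX, hc.symm⟩,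
    dist_comm (u : Plane) (v : Plane) ▸ h.2⟩⟩
  loopless := ⟨fun _ h => let ⟨_, _, hc⟩ := h.1; hc.2.2.1 rfl⟩

/-- `A` is a simple arc in the plane with endpoints `p` and `q`. -/
def IsSimpleArc (A : Set Plane) (p q : Plane) : Prop :=
  ∃ γ : unitInterval → Plane, Continuous γ ∧ Function.Injective γ ∧ γ 0 = p ∧ γ 1 = q ∧
    Set.range γ = A

/-- A drawing of the graph `G` in the plane without crossings: the vertices are represented by
different points, each edge by a simple arc that joins its two endvertices and contains no other
vertex, and two different arcs meet at most in common endvertices. -/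
structure IsPlaneDrawing {V : Type*} (G : SimpleGraph V) (pos : V → Plane)
    (arc : Sym2 V → Set Plane) : Prop where
  injective : Function.Injective pos
  isSimpleArc : ∀ u v, G.Adj u v → IsSimpleArc (arc s(u, v)) (pos u) (pos v)
  vertex : ∀ e ∈ G.edgeSet, ∀ w, pos w ∈ arc e → w ∈ e
  disjoint : ∀ e ∈ G.edgeSet, ∀ e' ∈ G.edgeSet, e ≠ e' →
    arc e ∩ arc e' ⊆ pos '' {w | w ∈ e ∧ w ∈ e'}

/-- A graph is planar if it has a drawing in the plane without crossings. -/
def IsPlanarGraph {V : Type*} (G : SimpleGraph V) : Prop :=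
  ∃ (pos : V → Plane) (arc : Sym2 V → Set Plane), IsPlaneDrawing G pos arc

/-- The segment that joins the two points of an unordered pair of points of `S`. -/
def pairSegment (S : Set Plane) (e : Sym2 S) : Set Plane :=
  convexHull ℝ (Subtype.val '' {w : S | w ∈ e})

open Filter Topology

/-! Smoothness enters through compactness: for small `τ`, two unit vectors that are both maximal on
`Γ`, up to `τ`, at one point `z` form an acute angle
(`IsSmoothConvexBody.exists_almost_normals_inner_pos`).

Let `ab` and `cd` be closest pairs in translates `X` and `Y` whose segments cross. If each translate
contains an endpoint of the other pair, minimality makes the two crossing diagonals together no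
longer than two opposite sides, against the triangle inequality (`false_of_opposite_sides`).

Otherwise, say, `Y = X + t` misses `a` and `b` but meets `[a, b]`. The part of `Y` on the side of
`ab` opposite to `t` lies in `X` (`mem_of_crossProd`). As `ab` is short, normals separating `a` and
`b` from `Y` form an acute angle, so each point of that part sees `ab` under an obtuse angle
(`inner_sub_neg_of_normals`) and is closer to `a` than `b` is. By minimality of `ab` no point of `S`
lies there, so `c` and `d` are on the same side of `ab` and `cd` cannot cross it. -/

/-- The signed area of the parallelogram spanned by two plane vectors. -/
def crossProd (v w : Plane) : ℝ := v 0 * w 1 - v 1 * w 0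

theorem inner_plane (v w : Plane) : inner ℝ v w = v 0 * w 0 + v 1 * w 1 := by
  simp [PiLp.inner_apply, Fin.sum_univ_two]; ring

/-! ### Almost normals and separation. -/

/-- Counterexamples for `τ = 1 / (k + 1)` form nested compact sets. A common point gives two exact
normals at one boundary point with nonpositive inner product; uniqueness of the tangent makes them
opposite, which flattens `Γ` into a line. -/
theorem IsSmoothConvexBody.exists_almost_normals_inner_pos {Γ : Set Plane}
    (hΓ : IsSmoothConvexBody Γ) :
    ∃ τ : ℝ, 0 < τ ∧ ∀ z ∈ Γ, ∀ n m : Plane, ‖n‖ = 1 → ‖m‖ = 1 →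
      (∀ y ∈ Γ, inner ℝ n y ≤ inner ℝ n z + τ) → (∀ y ∈ Γ, inner ℝ m y ≤ inner ℝ m z + τ) →
      0 < inner ℝ n m := by
  by_contra! hcon
  let F : ℕ → Set (Plane × Plane × Plane) := fun k =>
    {w | w ∈ Γ ×ˢ (Metric.sphere (0 : Plane) 1 ×ˢ Metric.sphere (0 : Plane) 1) ∧
      (∀ y ∈ Γ, inner ℝ w.2.1 y ≤ inner ℝ w.2.1 w.1 + 1 / ((k : ℝ) + 1)) ∧
      (∀ y ∈ Γ, inner ℝ w.2.2 y ≤ inner ℝ w.2.2 w.1 + 1 / ((k : ℝ) + 1)) ∧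
      inner ℝ w.2.1 w.2.2 ≤ 0}
  have hK : IsCompact (Γ ×ˢ (Metric.sphere (0 : Plane) 1 ×ˢ Metric.sphere (0 : Plane) 1)) :=
    hΓ.isCompact.prod ((isCompact_sphere _ _).prod (isCompact_sphere _ _))
  have hclosed : ∀ k, IsClosed (F k) := by
    intro k
    refine hK.isClosed.inter (IsClosed.inter ?_ (IsClosed.inter ?_ ?_))
    · change IsClosed {w : Plane × Plane × Plane | ∀ y ∈ Γ, _}
      simp only [Set.ofPred_forall]
      exact isClosed_biInter fun y _ => isClosed_le (by fun_prop) (by fun_prop)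
    · change IsClosed {w : Plane × Plane × Plane | ∀ y ∈ Γ, _}
      simp only [Set.ofPred_forall]
      exact isClosed_biInter fun y _ => isClosed_le (by fun_prop) (by fun_prop)
    · change IsClosed {w : Plane × Plane × Plane | inner ℝ w.2.1 w.2.2 ≤ 0}
      exact isClosed_le (by fun_prop) (by fun_prop)
  obtain ⟨⟨z, n, m⟩, hw⟩ := IsCompact.nonempty_iInter_of_sequence_nonempty_isCompact_isClosed F
    (by
      rintro k ⟨z, n, m⟩ ⟨h1, h2, h3, h4⟩
      have hle : 1 / (((k + 1 : ℕ) : ℝ) + 1) ≤ 1 / ((k : ℝ) + 1) := by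
        apply one_div_le_one_div_of_le <;> push_cast <;> linarith [(Nat.cast_nonneg k : (0:ℝ) ≤ k)]
      exact ⟨h1, fun y hy => (h2 y hy).trans (by simpa using hle),
        fun y hy => (h3 y hy).trans (by simpa using hle), h4⟩)
    (by
      intro k
      obtain ⟨z, hz, n, m, hn, hm, h1, h2, h3⟩ := hcon (1 / ((k : ℝ) + 1)) (by positivity)
      exact ⟨(z, n, m), ⟨hz, by simpa using hn, by simpa using hm⟩, h1, h2, h3⟩)
    (hK.of_isClosed_subset (hclosed 0) fun w hw => hw.1) hclosed
  rw [Set.mem_iInter] at hw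
  have hz : z ∈ Γ := (hw 0).1.1
  have hn : ‖n‖ = 1 := by simpa using (hw 0).1.2.1
  have hm : ‖m‖ = 1 := by simpa using (hw 0).1.2.2
  have hnm : inner ℝ n m ≤ 0 := (hw 0).2.2.2
  have hlim : ∀ r : ℝ, Tendsto (fun k : ℕ => r + 1 / ((k : ℝ) + 1)) atTop (𝓝 r) := by
    intro r
    simpa using (tendsto_const_nhds (x := r)).add tendsto_one_div_add_atTop_nhds_zero_nat
  have h1 : ∀ y ∈ Γ, inner ℝ n y ≤ inner ℝ n z := fun y hy =>
    ge_of_tendsto' (hlim _) fun k => (hw k).2.1 y hy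
  have h2 : ∀ y ∈ Γ, inner ℝ m y ≤ inner ℝ m z := fun y hy =>
    ge_of_tendsto' (hlim _) fun k => (hw k).2.2.1 y hy
  have hn0 : n ≠ 0 := by rintro rfl; simp at hn
  have hm0 : m ≠ 0 := by rintro rfl; simp at hm
  have hstrict : ∀ y ∈ interior Γ, inner ℝ n y < inner ℝ n z := by
    intro y hy
    have hc : Tendsto (fun s : ℝ => y + s • n) (𝓝[>] 0) (𝓝 y) := by
      have : Continuous (fun s : ℝ => y + s • n) := by fun_prop
      simpa using (this.tendsto 0).mono_left nhdsWithin_le_nhds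
    obtain ⟨s, hs, hs0⟩ := ((hc.eventually (mem_interior_iff_mem_nhds.1 hy)).and
      self_mem_nhdsWithin).exists
    have := h1 _ hs
    rw [inner_add_right, inner_smul_right, real_inner_self_eq_norm_sq, hn] at this
    have hs0 : 0 < s := hs0
    linarith
  have hfr : z ∈ frontier Γ := by
    rw [frontier, hΓ.isCompact.isClosed.closure_eq]
    exact ⟨hz, fun hi => lt_irrefl _ (hstrict z hi)⟩
  have hL : {y | inner ℝ n y = inner ℝ n z} = {y | inner ℝ m y = inner ℝ m z} :=
    (hΓ.smooth z hfr).unique ⟨n, hn0, rfl, h1⟩ ⟨m, hm0, rfl, h2⟩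
  -- Move from `z` along the common tangent line, by the quarter turn of `n`.
  have hpar : n 0 * m 1 - n 1 * m 0 = 0 := by
    have : z + !₂[-n 1, n 0] ∈ {y | inner ℝ n y = inner ℝ n z} := by
      simp [inner_plane]; ring
    rw [hL] at this
    simp [inner_plane] at this
    linarith
  have hn2 : n 0 * n 0 + n 1 * n 1 = 1 := by
    rw [← inner_plane, real_inner_self_eq_norm_sq, hn]; norm_num
  have hm2 : m 0 * m 0 + m 1 * m 1 = 1 := by
    rw [← inner_plane, real_inner_self_eq_norm_sq, hm]; norm_num
  obtain ⟨y, hy⟩ := hΓ.interior_nonempty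
  have e1 := hstrict y hy
  have e2 := h2 y (interior_subset hy)
  simp only [inner_plane] at hnm e1 e2
  -- `m` is the multiple of `n` by their (nonpositive) inner product
  have hm0' : m 0 = (n 0 * m 0 + n 1 * m 1) * n 0 := by linear_combination (-m 0) * hn2 - n 1 * hpar
  have hm1' : m 1 = (n 0 * m 0 + n 1 * m 1) * n 1 := by linear_combination (-m 1) * hn2 + n 0 * hpar
  set q := n 0 * m 0 + n 1 * m 1
  have hq : q < 0 := by
    rcases hnm.lt_or_eq with h | h
    · exact h
    · rw [h] at hm0' hm1'
      rw [hm0', hm1'] at hm2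
      norm_num at hm2
  rw [hm0', hm1'] at e2
  nlinarith [mul_pos_of_neg_of_neg hq (sub_neg.2 e1)]

/-- A closed convex set is strictly separated from an outside point by a unit normal. -/
theorem exists_unit_normal_of_notMem {Y : Set Plane} (hc : Convex ℝ Y) (hcl : IsClosed Y)
    (hne : Y.Nonempty) {a : Plane} (ha : a ∉ Y) :
    ∃ n : Plane, ‖n‖ = 1 ∧ ∀ y ∈ Y, inner ℝ n y < inner ℝ n a := by
  obtain ⟨f, u, h1, h2⟩ := geometric_hahn_banach_closed_point hc hcl ha
  set v := (InnerProductSpace.toDual ℝ Plane).symm f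
  have hv : ∀ y, inner ℝ v y = f y := fun y => InnerProductSpace.toDual_symm_apply
  have hlt : ∀ y ∈ Y, inner ℝ v y < inner ℝ v a := fun y hy => by
    rw [hv, hv]; exact (h1 y hy).trans h2
  have hv0 : v ≠ 0 := by
    rintro h
    obtain ⟨y, hy⟩ := hne
    simpa [h] using hlt y hy
  refine ⟨‖v‖⁻¹ • v, by simp [norm_smul, hv0], fun y hy => ?_⟩
  rw [real_inner_smul_left, real_inner_smul_left]
  have : 0 < ‖v‖⁻¹ := by positivity
  exact mul_lt_mul_of_pos_left (hlt y hy) this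

/-! ### The two sides of the line `ab`. -/

theorem exists_eq_smul_of_crossProd_eq_zero {e v : Plane} (he : e ≠ 0) (h : crossProd e v = 0) :
    ∃ r : ℝ, v = r • e := by
  have hL : e 0 * e 0 + e 1 * e 1 ≠ 0 := by
    rw [← inner_plane]; exact inner_self_ne_zero.2 he
  refine ⟨(e 0 * v 0 + e 1 * v 1) / (e 0 * e 0 + e 1 * e 1), ?_⟩
  unfold crossProd at h
  ext i
  fin_cases i <;> simp only [Fin.zero_eta, Fin.mk_one, PiLp.smul_apply, smul_eq_mul,
    div_mul_eq_mul_div] <;> rw [eq_div_iff hL]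
  · linear_combination (-e 1) * h
  · linear_combination (e 0) * h

theorem Convex.add_smul_mem_of_le_of_le {Y : Set Plane} (hY : Convex ℝ Y) {a e : Plane} {p q w : ℝ}
    (hp : a + p • e ∈ Y) (hq : a + q • e ∈ Y) (hpw : p ≤ w) (hwq : w ≤ q) : a + w • e ∈ Y := by
  rcases eq_or_lt_of_le (hpw.trans hwq) with h | h
  · have : w = p := by linarith
    rwa [this]
  · have h' : q - p ≠ 0 := (sub_pos.2 h).ne'
    have := hY hp hq (a := (q - w) / (q - p)) (b := (w - p) / (q - p))
      (div_nonneg (by linarith) (by linarith)) (div_nonneg (by linarith) (by linarith))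
      (by field_simp; ring)
    convert this using 1
    match_scalars <;> field_simp <;> ring

/-- If the endpoints of a segment that meets `Y = X + t` lie in `X` but not in `Y`, then `X`
contains the part of `Y` on the side of the segment opposite to `t`. -/
theorem mem_of_crossProd {X Y : Set Plane} (hX : Convex ℝ X) (hY : Convex ℝ Y) {t : Plane}
    (ht : ∀ y, y ∈ X ↔ y + t ∈ Y) {a b d : Plane} (ha : a ∈ X) (hb : b ∈ X) (ha' : a ∉ Y)
    (hb' : b ∉ Y) (hd : d ∈ Y) {s : ℝ} (hs0 : 0 ≤ s) (hs1 : s ≤ 1) (hs : a + s • (b - a) ∈ Y)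
    (hT : crossProd (b - a) t < 0) (hD : 0 < crossProd (b - a) (d - a)) : d ∈ X := by
  set e := b - a with he
  have hbe : b = a + e := by simp [he]
  -- This `k` puts `d + k • t` on the line `ab`; `r` below is its parameter there.
  obtain ⟨k, hk⟩ : ∃ k, k = crossProd e (d - a) / (-crossProd e t) := ⟨_, rfl⟩
  have hk0 : 0 < k := hk ▸ div_pos hD (by linarith)
  have hkT : crossProd e (d - a) + k * crossProd e t = 0 := by
    rw [hk]; field_simp [hT.ne]; ring
  have he0 : e ≠ 0 := by
    rintro h
    simp [crossProd, h] at hT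
  obtain ⟨r, hr'⟩ := exists_eq_smul_of_crossProd_eq_zero he0 (v := d - a + k • t) (by
    rw [← hkT]; simp [crossProd]; ring)
  have hr : d + k • t = a + r • e := by rw [← hr']; abel
  have hk1 : 0 < 1 + k := by linarith
  have hde : d = a + r • e - k • t := by rw [← hr]; simp
  -- The segment from `d` to `a + t` meets the line before `a`, which traps `a` between two points
  -- of `Y`. The case `1 < r` does the same with `b`.
  by_cases hr0 : r < 0
  · have := hY hd ((ht a).1 ha) (a := 1 / (1 + k)) (b := k / (1 + k)) (by positivity)
      (by positivity) (by field_simp)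
    have h2 : a + (r / (1 + k)) • e ∈ Y := by
      convert this using 1
      rw [hde]
      match_scalars <;> field_simp <;> ring
    refine absurd ?_ ha'
    simpa using hY.add_smul_mem_of_le_of_le h2 hs (w := 0) (div_nonpos_of_nonpos_of_nonneg hr0.le hk1.le) hs0
  by_cases hr1 : 1 < r
  · have := hY hd ((ht b).1 hb) (a := 1 / (1 + k)) (b := k / (1 + k)) (by positivity)
      (by positivity) (by field_simp)
    have h2 : a + ((r + k) / (1 + k)) • e ∈ Y := by
      convert this using 1
      rw [hde, hbe]
      match_scalars <;> field_simp <;> ring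
    refine absurd ?_ hb'
    rw [hbe]
    simpa using hY.add_smul_mem_of_le_of_le hs h2 (w := 1) hs1 (by rw [le_div_iff₀ hk1]; linarith)
  -- Now `d` lies between `d + k • t`, a point of `[a, b]`, and `d - t`, both in `X`.
  have hp : a + r • e ∈ X := by
    have := hX ha hb (a := 1 - r) (b := r) (by linarith) (by linarith) (by ring)
    convert this using 1
    rw [hbe]; module
  have hdt : d - t ∈ X := (ht _).2 (by simpa using hd)
  have := hX hp hdt (a := 1 / (1 + k)) (b := k / (1 + k)) (by positivity)
      (by positivity) (by field_simp)
  convert this using 1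
  rw [hde]
  match_scalars <;> field_simp <;> ring

/-- If `n` and `m` separate `a` and `b` from `d`, from the translates `a + t`, `b + t` and from a
point of `[a, b]`, the angle between them is acute, and `d` and `t` lie on opposite sides of `ab`,
then the angle `a d b` is obtuse. -/
theorem inner_sub_neg_of_normals {a b d t n m : Plane} {s : ℝ} (hs0 : 0 ≤ s) (hs1 : s ≤ 1)
    (hT : crossProd (b - a) t < 0) (hD : 0 < crossProd (b - a) (d - a))
    (hnx : inner ℝ n (a + s • (b - a)) < inner ℝ n a)
    (hmx : inner ℝ m (a + s • (b - a)) < inner ℝ m b)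
    (hnt : inner ℝ n (a + t) < inner ℝ n a) (hmt : inner ℝ m (b + t) < inner ℝ m b)
    (hnd : inner ℝ n d < inner ℝ n a) (hmd : inner ℝ m d < inner ℝ m b)
    (hnm : 0 < inner ℝ n m) : inner ℝ (d - a) (d - b) < 0 := by
  obtain ⟨e, rfl⟩ : ∃ e, b = a + e := ⟨b - a, by simp⟩
  obtain ⟨f, rfl⟩ : ∃ f, d = a + f := ⟨d - a, by simp⟩
  simp only [add_sub_cancel_left, add_sub_add_left_eq_sub, inner_plane, crossProd, PiLp.add_apply,
    PiLp.smul_apply, PiLp.sub_apply, smul_eq_mul] at *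
  generalize e 0 = e0 at *
  generalize e 1 = e1 at *
  generalize f 0 = f0 at *
  generalize f 1 = f1 at *
  generalize n 0 = n0 at *
  generalize n 1 = n1 at *
  generalize m 0 = m0 at *
  generalize m 1 = m1 at *
  generalize t 0 = t0 at *
  generalize t 1 = t1 at *
  -- components along `e` and along its quarter turn
  obtain ⟨α, hα⟩ : ∃ α, α = -(n0 * e0 + n1 * e1) := ⟨_, rfl⟩
  obtain ⟨β, hβ⟩ : ∃ β, β = m0 * e0 + m1 * e1 := ⟨_, rfl⟩
  obtain ⟨P, hP⟩ : ∃ P, P = n1 * e0 - n0 * e1 := ⟨_, rfl⟩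
  obtain ⟨Q, hQ⟩ : ∃ Q, Q = m1 * e0 - m0 * e1 := ⟨_, rfl⟩
  obtain ⟨T, hT'⟩ : ∃ T, T = e0 * t1 - e1 * t0 := ⟨_, rfl⟩
  obtain ⟨D, hD'⟩ : ∃ D, D = e0 * f1 - e1 * f0 := ⟨_, rfl⟩
  obtain ⟨x, hx⟩ : ∃ x, x = e0 * f0 + e1 * f1 := ⟨_, rfl⟩
  obtain ⟨y, hy⟩ : ∃ y, y = e0 * t0 + e1 * t1 := ⟨_, rfl⟩
  obtain ⟨L, hL'⟩ : ∃ L, L = e0 * e0 + e1 * e1 := ⟨_, rfl⟩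
  rw [← hT'] at hT
  rw [← hD'] at hD
  have hL : 0 < L := by
    by_contra! h
    have h0 : e0 = 0 := by nlinarith [mul_self_nonneg e0, mul_self_nonneg e1]
    have h1 : e1 = 0 := by nlinarith [mul_self_nonneg e0, mul_self_nonneg e1]
    rw [hD', h0, h1] at hD; simp at hD
  have hα0 : 0 < α := by
    by_contra! h
    have : s * α ≤ 0 := mul_nonpos_of_nonneg_of_nonpos hs0 h
    rw [hα] at this; linarith
  have hβ0 : 0 < β := by
    by_contra! h
    have : (1 - s) * β ≤ 0 := mul_nonpos_of_nonneg_of_nonpos (by linarith) h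
    rw [hβ] at this; linarith
  have i1 : α * β < P * Q := by
    have := mul_pos hL hnm
    have e : L * (n0 * m0 + n1 * m1) = P * Q - α * β := by subst_vars; ring
    linarith
  have i2 : -α * y + P * T < 0 := by
    have := mul_neg_of_pos_of_neg hL (by linarith : n0 * t0 + n1 * t1 < 0)
    have e : L * (n0 * t0 + n1 * t1) = -α * y + P * T := by subst_vars; ring
    linarith
  have i3 : β * y + Q * T < 0 := by
    have := mul_neg_of_pos_of_neg hL (by linarith : m0 * t0 + m1 * t1 < 0)
    have e : L * (m0 * t0 + m1 * t1) = β * y + Q * T := by subst_vars; ring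
    linarith
  have i4 : P * D < α * x := by
    have := mul_neg_of_pos_of_neg hL (by linarith : n0 * f0 + n1 * f1 < 0)
    have e : L * (n0 * f0 + n1 * f1) = -α * x + P * D := by subst_vars; ring
    linarith
  have i5 : Q * D < β * (L - x) := by
    have := mul_neg_of_pos_of_neg hL (by linarith : m0 * (f0 - e0) + m1 * (f1 - e1) < 0)
    have e : L * (m0 * (f0 - e0) + m1 * (f1 - e1)) = β * (x - L) + Q * D := by subst_vars; ring
    linarith
  -- Weighting `i2` by `β` and `i3` by `α` eliminates `y`. With `P * Q > 0` from `i1`, both `P` and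
  -- `Q` are then positive.
  have i6 : 0 < β * P + α * Q := by
    by_contra! h
    have j2 := mul_neg_of_pos_of_neg hβ0 i2
    have j3 := mul_neg_of_pos_of_neg hα0 i3
    have j4 := mul_nonneg_of_nonpos_of_nonpos h hT.le
    linarith
  have hαβ := mul_pos hα0 hβ0
  have hP0 : 0 < P := by
    by_contra! h
    have hQ0 : Q ≤ 0 := by
      by_contra! h'
      linarith [mul_nonpos_of_nonpos_of_nonneg h h'.le]
    linarith [mul_nonpos_of_nonneg_of_nonpos hβ0.le h, mul_nonpos_of_nonneg_of_nonpos hα0.le hQ0]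
  have hQ0 : 0 < Q := by
    by_contra! h
    linarith [mul_nonpos_of_nonneg_of_nonpos hP0.le h]
  have i7 : P * D * (Q * D) < α * x * (β * (L - x)) :=
    mul_lt_mul'' i4 i5 (by positivity) (by positivity)
  have i8 : α * β * (D * D) < P * Q * (D * D) := mul_lt_mul_of_pos_right i1 (by positivity)
  -- Thales: `d` is inside the circle with diameter `ab`.
  have i9 : D * D < x * (L - x) := by
    refine lt_of_mul_lt_mul_left ?_ hαβ.le
    linarith
  have e : L * (f0 * (f0 - e0) + f1 * (f1 - e1)) = x * (x - L) + D * D := by subst_vars; ring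
  by_contra! h
  linarith [mul_nonneg hL.le h]

/-! ### Closest pairs and their segments. -/

theorem IsClosestPair.endpoint_of_mem_segment {S X : Set Plane} (hX : Convex ℝ X) {a b c : Plane}
    (h : IsClosestPair (S ∩ X) a b) (hc : c ∈ S) (hcs : c ∈ segment ℝ a b) : c = a ∨ c = b := by
  by_contra! hne
  have hcX := hX.segment_subset h.1.2 h.2.1.2 hcs
  have h1 := h.2.2.2 a h.1 c ⟨hc, hcX⟩ hne.1.symm
  have h2 := dist_add_dist_of_mem_segment hcs
  exact hne.2 (dist_le_zero.1 (by linarith))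

theorem mem_segment_of_same_ray {b a d x : Plane} (hxb : x ≠ b) (h1 : x ∈ segment ℝ a b)
    (h2 : x ∈ segment ℝ b d) : a ∈ segment ℝ b d ∨ d ∈ segment ℝ a b := by
  rw [segment_symm] at h1
  rw [segment_symm ℝ a b]
  simp only [segment_eq_image'] at *
  obtain ⟨p, ⟨hp0, hp1⟩, rfl⟩ := h1
  obtain ⟨q, ⟨hq0, hq1⟩, hq⟩ := h2
  simp only [add_right_inj] at hq
  have hp : 0 < p := lt_of_le_of_ne hp0 (by rintro rfl; exact hxb (by simp))
  have hq' : 0 < q := lt_of_le_of_ne hq0 (by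
    rintro rfl
    rw [zero_smul] at hq
    exact hxb (by simp [← hq]))
  rcases le_total p q with h | h
  · right
    refine ⟨p / q, ⟨by positivity, (div_le_one hq').2 h⟩, ?_⟩
    have : (p / q) • (a - b) = d - b := by
      rw [div_eq_inv_mul, mul_smul, ← hq, smul_smul, inv_mul_cancel₀ hq'.ne', one_smul]
    simp [this]
  · left
    refine ⟨q / p, ⟨by positivity, (div_le_one hp).2 h⟩, ?_⟩
    have : (q / p) • (d - b) = a - b := by
      rw [div_eq_inv_mul, mul_smul, hq, smul_smul, inv_mul_cancel₀ hp.ne', one_smul]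
    simp [this]

/-- Closest pairs with a common point do not overlap. -/
theorem eq_of_common_endpoint {S X Y : Set Plane} (hX : Convex ℝ X) (hY : Convex ℝ Y)
    {a b d x : Plane} (h1 : IsClosestPair (S ∩ X) a b) (h2 : IsClosestPair (S ∩ Y) b d)
    (hx1 : x ∈ segment ℝ a b) (hx2 : x ∈ segment ℝ b d) (hxb : x ≠ b) : a = d := by
  rcases mem_segment_of_same_ray hxb hx1 hx2 with h | h
  · exact (h2.endpoint_of_mem_segment hY h1.1.1 h).resolve_left h1.2.2.1
  · exact ((h1.endpoint_of_mem_segment hX h2.2.1.1 h).resolve_right h2.2.2.1.symm).symm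

/-- Crossing diagonals are together longer than two opposite sides. -/
theorem false_of_opposite_sides {a b c d x : Plane} (hbc : b ≠ c) (hda : a ≠ d)
    (hx1 : x ∈ segment ℝ a b) (hx2 : x ∈ segment ℝ c d)
    (h1 : dist a b ≤ dist a c) (h2 : dist c d ≤ dist b d) : False := by
  have e1 := dist_add_dist_of_mem_segment hx1
  have e2 := dist_add_dist_of_mem_segment hx2
  have t1 := dist_triangle a x c
  have t2 := dist_triangle b x d
  rw [dist_comm c x] at e2
  rw [dist_comm b x] at t2
  -- Equality is forced in both triangle inequalities, so `b` and `c` lie at equal distance from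
  -- `x`, on the ray opposite to `a` (or to `d`, if `a = x`).
  have f1 : dist a x + dist x c = dist a c := by linarith
  have f2 : dist b x + dist x d = dist b d := by rw [dist_comm b x]; linarith
  have f3 : dist x b = dist x c := by linarith
  have w1 : Wbtw ℝ a x b := dist_add_dist_eq_iff.1 e1
  have w2 : Wbtw ℝ a x c := dist_add_dist_eq_iff.1 f1
  have w3 : Wbtw ℝ c x d := dist_add_dist_eq_iff.1 (by rw [dist_comm c x]; exact e2)
  have w4 : Wbtw ℝ b x d := dist_add_dist_eq_iff.1 f2
  have key : ∀ p : Plane, p ≠ x → Wbtw ℝ p x b → Wbtw ℝ p x c → b = c := by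
    intro p hp h h'
    have s1 : SameRay ℝ (x - p) (b - x) := by simpa using h.sameRay_vsub
    have s2 : SameRay ℝ (x - p) (c - x) := by simpa using h'.sameRay_vsub
    have s3 := s1.symm.trans s2 fun h0 => absurd (sub_eq_zero.1 h0).symm hp
    have := s3.norm_eq_iff.1 (by rw [← dist_eq_norm, ← dist_eq_norm, dist_comm b, dist_comm c, f3])
    simpa using this
  by_cases hax : a = x
  · by_cases hdx : d = x
    · exact hda (hax.trans hdx.symm)
    · exact hbc (key d hdx w4.symm w3.symm)
  · exact hbc (key a hax w1 w2)

/-! ### Crossing pairs. -/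

/-- The case of two crossing closest pairs where the translate of the second one misses both points
of the first one. -/
theorem false_of_notMem_translate {Γ S : Set Plane} (hc : Convex ℝ Γ) (hcl : IsClosed Γ) {τ : ℝ}
    (hτ : ∀ z ∈ Γ, ∀ n m : Plane, ‖n‖ = 1 → ‖m‖ = 1 →
      (∀ y ∈ Γ, inner ℝ n y ≤ inner ℝ n z + τ) → (∀ y ∈ Γ, inner ℝ m y ≤ inner ℝ m z + τ) →
      0 < inner ℝ n m) {p q : Plane} {X Y : Set Plane} (hXp : X = (fun x => p + x) '' Γ)
    (hYq : Y = (fun x => q + x) '' Γ) {a b c d : Plane} (h1 : IsClosestPair (S ∩ X) a b)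
    (h2 : IsClosestPair (S ∩ Y) c d) (hab : dist a b ≤ τ) (ha : a ∉ Y) (hb : b ∉ Y)
    {x : Plane} (hx1 : x ∈ segment ℝ a b) (hx2 : x ∈ segment ℝ c d) : False := by
  have hX : Convex ℝ X := hXp ▸ hc.translate p
  have hY : Convex ℝ Y := hYq ▸ hc.translate q
  have hYcl : IsClosed Y := by
    rw [hYq]; exact (Homeomorph.addLeft q).isClosedMap _ hcl
  have hXm : ∀ y, y ∈ X ↔ y - p ∈ Γ := fun y => by
    rw [hXp]; exact ⟨by rintro ⟨z, hz, rfl⟩; simpa, fun h => ⟨_, h, by simp⟩⟩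
  have hYm : ∀ y, y ∈ Y ↔ y - q ∈ Γ := fun y => by
    rw [hYq]; exact ⟨by rintro ⟨z, hz, rfl⟩; simpa, fun h => ⟨_, h, by simp⟩⟩
  have hxY : x ∈ Y := hY.segment_subset h2.1.2 h2.2.1.2 hx2
  -- separating normals at `a` and `b` form an acute angle
  have hnormals : ∃ n m : Plane, (∀ y ∈ Y, inner ℝ n y < inner ℝ n a) ∧
      (∀ y ∈ Y, inner ℝ m y < inner ℝ m b) ∧ 0 < inner ℝ n m := by
    obtain ⟨n, hn, hna⟩ := exists_unit_normal_of_notMem hY hYcl ⟨x, hxY⟩ ha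
    obtain ⟨m, hm, hmb⟩ := exists_unit_normal_of_notMem hY hYcl ⟨x, hxY⟩ hb
    -- The crossing point `x` is in `Y` and within `τ` of both `a` and `b`, so both normals are
    -- almost maximal there.
    refine ⟨n, m, hna, hmb, hτ (x - q) ((hYm x).1 hxY) n m hn hm ?_ ?_⟩
    all_goals
      intro y hy
      have e := dist_add_dist_of_mem_segment hx1
    · have h := hna (q + y) ((hYm _).2 (by simpa using hy))
      have h' := real_inner_le_norm n (a - x)
      rw [hn, one_mul, ← dist_eq_norm, inner_sub_right] at h'
      rw [inner_add_right] at h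
      rw [inner_sub_right]
      linarith [dist_nonneg (x := x) (y := b)]
    · have h := hmb (q + y) ((hYm _).2 (by simpa using hy))
      have h' := real_inner_le_norm m (b - x)
      rw [hm, one_mul, ← dist_eq_norm, inner_sub_right, dist_comm] at h'
      rw [inner_add_right] at h
      rw [inner_sub_right]
      linarith [dist_nonneg (x := a) (y := x)]
  obtain ⟨n, m, hna, hmb, hnm⟩ := hnormals
  obtain ⟨t, rfl⟩ : ∃ t, q = p + t := ⟨q - p, by simp⟩
  have ht : ∀ y, y ∈ X ↔ y + t ∈ Y := fun y => by
    rw [hXm, hYm]; congr! 1; abel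
  have hat := (ht a).1 h1.1.2
  have hbt := (ht b).1 h1.2.1.2
  -- By the law of cosines, an obtuse angle at `z` would make `az` shorter than `ab`.
  have hobt : ∀ z ∈ S, z ∈ Y → z ∈ X → 0 ≤ inner ℝ (z - a) (z - b) := by
    intro z hzS hzY hzX
    have hd := h1.2.2.2 a h1.1 z ⟨hzS, hzX⟩ (by rintro rfl; exact ha hzY)
    rw [dist_eq_norm, dist_eq_norm, ← norm_neg (a - z), neg_sub] at hd
    have hsq : ‖a - b‖ ^ 2 = ‖z - b‖ ^ 2 - 2 * inner ℝ (z - b) (z - a) + ‖z - a‖ ^ 2 := by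
      rw [← norm_sub_sq_real]; congr 2; abel
    by_contra! hneg
    rw [real_inner_comm] at hneg
    nlinarith [norm_nonneg (a - b), norm_nonneg (z - a), sq_nonneg ‖z - b‖]
  rw [segment_eq_image'] at hx1
  obtain ⟨s, ⟨hs0, hs1⟩, rfl⟩ := hx1
  have hxY' : b + (1 - s) • (a - b) ∈ Y := by
    convert hxY using 1
    module
  have hpos : ∀ z ∈ S, z ∈ Y → crossProd (b - a) t < 0 → crossProd (b - a) (z - a) ≤ 0 := by
    intro z hzS hzY hT
    by_contra! hD
    have hzX := mem_of_crossProd hX hY ht h1.1.2 h1.2.1.2 ha hb hzY hs0 hs1 hxY hT hD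
    exact (hobt z hzS hzY hzX).not_gt (inner_sub_neg_of_normals hs0 hs1 hT hD (hna _ hxY)
      (hmb _ hxY) (hna _ hat) (hmb _ hbt) (hna _ hzY) (hmb _ hzY) hnm)
  have hneg : ∀ z ∈ S, z ∈ Y → 0 < crossProd (b - a) t → 0 ≤ crossProd (b - a) (z - a) := by
    intro z hzS hzY hT
    by_contra! hD
    have hT' : crossProd (a - b) t < 0 := by
      have : crossProd (a - b) t = -crossProd (b - a) t := by simp [crossProd]; ring
      linarith
    have hD' : 0 < crossProd (a - b) (z - b) := by
      have : crossProd (a - b) (z - b) = -crossProd (b - a) (z - a) := by simp [crossProd]; ring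
      linarith
    have hzX := mem_of_crossProd hX hY ht h1.2.1.2 h1.1.2 hb ha hzY (by linarith : 0 ≤ 1 - s)
      (by linarith) hxY' hT' hD'
    refine (hobt z hzS hzY hzX).not_gt ?_
    rw [real_inner_comm]
    exact inner_sub_neg_of_normals (by linarith : 0 ≤ 1 - s) (by linarith) hT' hD' (hmb _ hxY')
      (hna _ hxY') (hmb _ hbt) (hna _ hat) (hmb _ hzY) (hna _ hzY) (by rwa [real_inner_comm])
  have he0 : b - a ≠ 0 := sub_ne_zero.2 h1.2.2.1.symm
  have hoff : ∀ z ∈ S, z ∈ Y → crossProd (b - a) (z - a) ≠ 0 := by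
    intro z hzS hzY h0
    obtain ⟨w, hw⟩ := exists_eq_smul_of_crossProd_eq_zero he0 h0
    have hz : z = a + w • (b - a) := by rw [← hw]; abel
    have hw0 : 0 ≤ w := by
      by_contra! h
      refine ha ?_
      simpa using hY.add_smul_mem_of_le_of_le (hz ▸ hzY) hxY (w := 0) h.le hs0
    have hw1 : w ≤ 1 := by
      by_contra! h
      refine hb ?_
      simpa using hY.add_smul_mem_of_le_of_le hxY (hz ▸ hzY) (w := 1) hs1 h.le
    rcases h1.endpoint_of_mem_segment hX hzS
      (by rw [segment_eq_image']; exact ⟨w, ⟨hw0, hw1⟩, hz.symm⟩) with rfl | rfl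
    · exact ha hzY
    · exact hb hzY
  obtain ⟨r₁, r₂, hr₁, hr₂, hr, hx⟩ := hx2
  have hzero : r₁ * crossProd (b - a) (c - a) + r₂ * crossProd (b - a) (d - a) = 0 := by
    have h0 : r₁ • (c - a) + r₂ • (d - a) = s • (b - a) := by
      have : r₁ • (c - a) + r₂ • (d - a) = r₁ • c + r₂ • d - (r₁ + r₂) • a := by module
      rw [this, hx, hr]; simp
    have e0 := congrArg (crossProd (b - a)) h0
    simp only [crossProd, PiLp.add_apply, PiLp.smul_apply, smul_eq_mul] at e0 ⊢
    linear_combination e0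
  have hc0 := hoff c h2.1.1 h2.1.2
  have hd0 := hoff d h2.2.1.1 h2.2.1.2
  rcases lt_trichotomy (crossProd (b - a) t) 0 with hT | hT | hT
  · have i1 := lt_of_le_of_ne (hpos c h2.1.1 h2.1.2 hT) hc0
    have i2 := lt_of_le_of_ne (hpos d h2.2.1.1 h2.2.1.2 hT) hd0
    exact (convex_Iio (0 : ℝ) i1 i2 hr₁ hr₂ hr : _ < (0 : ℝ)).ne hzero
  -- If `t` is parallel to `ab`, then `b` lies between `x` and `b + t`, or `a` between `a + t` and
  -- `x`, all on one line.
  · obtain ⟨w, rfl⟩ := exists_eq_smul_of_crossProd_eq_zero he0 hT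
    rcases le_total 0 w with h | h
    · refine hb ?_
      have : a + (1 + w) • (b - a) ∈ Y := by
        convert hbt using 1
        module
      simpa using hY.add_smul_mem_of_le_of_le hxY this (w := 1) hs1 (by linarith)
    · refine ha ?_
      simpa using hY.add_smul_mem_of_le_of_le hat hxY (w := 0) h hs0
  · have i1 := lt_of_le_of_ne (hneg c h2.1.1 h2.1.2 hT) hc0.symm
    have i2 := lt_of_le_of_ne (hneg d h2.2.1.1 h2.2.1.2 hT) hd0.symm
    exact (convex_Ioi (0 : ℝ) i1 i2 hr₁ hr₂ hr : (0 : ℝ) < _).ne' hzero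

/-- Short candidate pairs do not cross. -/
theorem IsSmoothConvexBody.exists_not_segmentsCross {Γ : Set Plane} (hΓ : IsSmoothConvexBody Γ) :
    ∃ τ : ℝ, 0 < τ ∧ ∀ (S : Set Plane) (a b c d : Plane),
      (a, b) ∈ candidatePairs S (translates Γ) → (c, d) ∈ candidatePairs S (translates Γ) →
      dist a b ≤ τ → dist c d ≤ τ → ¬ SegmentsCross a b c d := by
  obtain ⟨τ, hτ0, hτ⟩ := hΓ.exists_almost_normals_inner_pos
  refine ⟨τ, hτ0, ?_⟩
  rintro S a b c d ⟨X, ⟨p, hXp⟩, h1⟩ ⟨Y, ⟨q, hYq⟩, h2⟩ hab hcd ⟨hne, x, ⟨hx1, hx2⟩, hx⟩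
  dsimp only at h1 h2
  have hX : Convex ℝ X := hXp ▸ hΓ.convex.translate p
  have hY : Convex ℝ Y := hYq ▸ hΓ.convex.translate q
  simp only [Set.mem_insert_iff, Set.mem_singleton_iff] at hx
  have hx1' := segment_symm ℝ a b ▸ hx1
  have hx2' := segment_symm ℝ c d ▸ hx2
  have hac : a ≠ c := by
    rintro rfl
    have := eq_of_common_endpoint hX hY h1.symm h2 hx1' hx2 (by tauto)
    exact hne (by rw [this])
  have had : a ≠ d := by
    rintro rfl
    have := eq_of_common_endpoint hX hY h1.symm h2.symm hx1' hx2' (by tauto)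
    exact hne (by rw [this, Sym2.eq_swap])
  have hbc : b ≠ c := by
    rintro rfl
    have := eq_of_common_endpoint hX hY h1 h2 hx1 hx2 (by tauto)
    exact hne (by rw [this, Sym2.eq_swap])
  have hbd : b ≠ d := by
    rintro rfl
    have := eq_of_common_endpoint hX hY h1 h2.symm hx1 hx2' (by tauto)
    exact hne (by rw [this])
  have key : ∀ a b c d : Plane, IsClosestPair (S ∩ X) a b → IsClosestPair (S ∩ Y) c d →
      a ≠ c → a ≠ d → b ≠ c → b ≠ d → x ∈ segment ℝ a b → x ∈ segment ℝ c d →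
      c ∈ X → b ∈ Y → False := by
    intro a b c d h1 h2 hac had hbc hbd hx1 hx2 hcX hbY
    exact false_of_opposite_sides hbc had hx1 hx2 (h1.2.2.2 a h1.1 c ⟨h2.1.1, hcX⟩ hac)
      (h2.2.2.2 b ⟨h1.2.1.1, hbY⟩ d h2.2.1 hbd)
  by_cases hY' : a ∉ Y ∧ b ∉ Y
  · exact false_of_notMem_translate hΓ.convex hΓ.isCompact.isClosed hτ hXp hYq h1 h2 hab
      hY'.1 hY'.2 hx1 hx2
  by_cases hX' : c ∉ X ∧ d ∉ X
  · exact false_of_notMem_translate hΓ.convex hΓ.isCompact.isClosed hτ hYq hXp h2 h1 hcd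
      hX'.1 hX'.2 hx2 hx1
  rw [not_and_or, not_not, not_not] at hX' hY'
  rcases hX' with hX' | hX' <;> rcases hY' with hY' | hY'
  · exact key b a c d h1.symm h2 hbc hbd hac had hx1' hx2 hX' hY'
  · exact key a b c d h1 h2 hac had hbc hbd hx1 hx2 hX' hY'
  · exact key b a d c h1.symm h2.symm hbd hbc had hac hx1' hx2' hX' hY'
  · exact key a b d c h1 h2.symm had hac hbd hbc hx1 hx2' hX' hY'

/-! ### The straight-line drawing. -/

theorem pairSegment_mk (S : Set Plane) (u v : S) :
    pairSegment S s(u, v) = segment ℝ (u : Plane) v := by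
  rw [pairSegment, ← convexHull_pair]
  congr 1
  ext y
  simp only [Set.mem_image, Set.mem_ofPred_eq, Sym2.mem_iff, Set.mem_insert_iff,
    Set.mem_singleton_iff]
  constructor
  · rintro ⟨w, rfl | rfl, rfl⟩ <;> simp
  · rintro (rfl | rfl)
    exacts [⟨u, .inl rfl, rfl⟩, ⟨v, .inr rfl, rfl⟩]

theorem isSimpleArc_segment {a b : Plane} (hab : a ≠ b) : IsSimpleArc (segment ℝ a b) a b := by
  refine ⟨fun s => AffineMap.lineMap a b (s : ℝ), ?_, ?_, by simp, by simp, ?_⟩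
  · exact AffineMap.lineMap_continuous.comp continuous_subtype_val
  · exact (AffineMap.lineMap_injective ℝ hab).comp Subtype.val_injective
  · rw [segment_eq_image_lineMap, Set.image_eq_range]

theorem isPlaneDrawing_pairSegment {S Γ : Set Plane} (hΓ : Convex ℝ Γ) {τ : ℝ}
    (h : ∀ a b c d : Plane,
      (a, b) ∈ candidatePairs S (translates Γ) → (c, d) ∈ candidatePairs S (translates Γ) →
      dist a b ≤ τ → dist c d ≤ τ → ¬ SegmentsCross a b c d) :
    IsPlaneDrawing (shortCandidateGraph S (translates Γ) τ) Subtype.val (pairSegment S) where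
  injective := Subtype.val_injective
  isSimpleArc u v huv := by
    rw [pairSegment_mk]
    exact isSimpleArc_segment fun he => huv.ne (Subtype.ext he)
  vertex e he w hw := by
    induction e with
    | h u v =>
      obtain ⟨⟨X, ⟨p, hX⟩, hc⟩, -⟩ := he
      rw [pairSegment_mk] at hw
      rw [Sym2.mem_iff]
      exact (hc.endpoint_of_mem_segment (hX ▸ hΓ.translate p) w.2 hw).imp Subtype.ext Subtype.ext
  disjoint e he e' he' hee' := by
    induction e with
    | h u v =>
    induction e' with
    | h u' v' =>
      rw [pairSegment_mk, pairSegment_mk]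
      intro x hx
      have hx' : x ∈ ({(u : Plane), (v : Plane)} : Set Plane) ∧
          x ∈ ({(u' : Plane), (v' : Plane)} : Set Plane) := by
        by_contra hcon
        refine h u v u' v' he.1 he'.1 he.2 he'.2 ⟨fun heq => hee' ?_, x, hx, hcon⟩
        exact Sym2.map.injective Subtype.val_injective (by simpa using heq)
      have mem : ∀ p q : S, x ∈ ({(p : Plane), (q : Plane)} : Set Plane) → ∀ w : S, (w : Plane) = x →
          w ∈ s(p, q) := by
        rintro p q hpq w rfl
        rw [Sym2.mem_iff]
        exact hpq.imp Subtype.ext Subtype.ext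
      have hxS : x ∈ S := by
        rcases hx'.1 with rfl | rfl
        exacts [u.2, v.2]
      exact ⟨⟨x, hxS⟩, ⟨mem _ _ hx'.1 _ rfl, mem _ _ hx'.2 _ rfl⟩, rfl⟩

theorem theorem7 (Γ : Set Plane) (hΓ : IsSmoothConvexBody Γ) :
    ∃ τ : ℝ, 0 < τ ∧ ∀ S : Set Plane,
      (∀ a b c d : Plane,
        (a, b) ∈ candidatePairs S (translates Γ) → (c, d) ∈ candidatePairs S (translates Γ) →
        dist a b ≤ τ → dist c d ≤ τ → ¬ SegmentsCross a b c d) ∧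
      (S.Finite →
        IsPlaneDrawing (shortCandidateGraph S (translates Γ) τ) Subtype.val (pairSegment S) ∧
        IsPlanarGraph (shortCandidateGraph S (translates Γ) τ)) := by
  obtain ⟨τ, hτ0, hτ⟩ := hΓ.exists_not_segmentsCross
  refine ⟨τ, hτ0, fun S => ⟨hτ S, fun _ => ?_⟩⟩
  have := isPlaneDrawing_pairSegment hΓ.convex (hτ S)
  exact ⟨this, _, _, this⟩
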